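/- Let $F/F_0$ be a quadratic extension of number fields, let $n_0=[F_0:\mathbb{Q}]$, and let $R$ be the set of real places of $F_0$ that become complex in $F$. A Hecke character of $F$ is a continuous homomorphism $\chi\colon C_F=\mathbb{A}_F^\times/F^\times\to\{z\in\mathbb{C}:|z|=1\}$. At a complex place $w$ of $F$ its local component has the form $\chi_w(z)=(z/|z|)^{k_w}|z|^{2i\varphi_w}$ for a unique pair $(k_w,\varphi_w)\in\mathbb{Z}\times\mathbb{R}$. A modulus $\mathfrak{m}=\mathfrak{m}_f\mathfrak{m}_\infty$ of $F$ consists of a nonzero integral ideal $\mathfrak{m}_f$ and a set $\mathfrak{m}_\infty$ of real places of $F$. Let $$U(\mathfrak{m})=\prod_{\mathfrak{p}\mid\mathfrak{m}_f}(1+\mathfrak{p}^{v_\mathfrak{p}(\mathfrak{m}_f)}\mathcal{O}_\mathfrak{p})\times\prod_{\mathfrak{p}\nmid\mathfrak{m}_f}\mathcal{O}_\mathfrak{p}^\times\times\prod_{\sigma\in\mathfrak{m}_\infty}\{1\}\times\prod_{\sigma\notin\mathfrak{m}_\infty,\ \sigma\text{ real}}\{\pm1\}\times\prod_{\sigma\text{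 complex}}\{1\},$$ let $\widehat{C}_{\mathfrak{m}}$ be the group of Hecke characters of $F$ that are trivial on $U(\mathfrak{m})$, and let $\widehat{C}^1_{\mathfrak{m}}\subset\widehat{C}_{\mathfrak{m}}$ be the subgroup of those that are also trivial on $\mathbb{R}_{>0}$, embedded diagonally in the archimedean components of the idèles (with finite components $1$); thus $\widehat{C}_{\mathfrak{m}}=\widehat{C}^1_{\mathfrak{m}}\times\|\cdot\|^{i\mathbb{R}}$. Then for every modulus $\mathfrak{m}$ of $F$ there exists a subgroup $H$ of $\widehat{C}_{\mathfrak{m}}$, contained in $\widehat{C}^1_{\mathfrak{m}}$, of rank $n_0$ as an abelian group (i.e. $\dim_{\mathbb{Q}}(H\otimes_{\mathbb{Z}}\mathbb{Q})=n_0$), such that every $\chi\in H$ satisfies $\varphi_\sigma=0$ for every $\sigma\in R$, that is, $\varphi_w=0$ for every place $w$ of $F$ above a place in $R$. -/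

import Mathlib

open scoped NumberField NumberField.AdeleRing

noncomputable section

namespace HeckeChar

open NumberField IsDedekindDomain

/-- The idèle group of a number field `F`, with its usual topology (that of the group of units of
the adèle ring). -/
abbrev IdeleGroup (F : Type*) [Field F] [NumberField F] : Type _ := (𝔸[F])ˣ

/-- The principal idèles, i.e. the image of `Fˣ` under the diagonal embedding. -/
def principalIdeles (F : Type*) [Field F] [NumberField F] : Subgroup (IdeleGroup F) :=
  (Units.map (algebraMap F 𝔸[F]).toMonoidHom).range

/-- The idèle class group `C_F = 𝔸_Fˣ / Fˣ`, with the quotient topology. -/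
abbrev IdeleClassGroup (F : Type*) [Field F] [NumberField F] : Type _ :=
  IdeleGroup F ⧸ principalIdeles F

/-- Hecke characters: continuous homomorphisms from `C_F` to the unit circle. -/
abbrev HeckeCharacter (F : Type*) [Field F] [NumberField F] : Type _ :=
  PontryaginDual (IdeleClassGroup F)

variable {F : Type*} [Field F] [NumberField F]

/-- The value of a Hecke character at an idèle. -/
def evalIdele (χ : HeckeCharacter F) (x : IdeleGroup F) : Circle :=
  χ (QuotientGroup.mk x)

/-- A modulus: a nonzero integral ideal together with a set of real places. -/
structure Modulus (F : Type*) [Field F] [NumberField F] where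
  /-- the finite part -/
  finitePart : Ideal (𝓞 F)
  finitePart_ne_bot : finitePart ≠ ⊥
  /-- the infinite part -/
  infinitePart : Set {v : InfinitePlace F // v.IsReal}

/-- The exponent of the prime `p` in the finite part of the modulus. -/
def Modulus.exponent (m : Modulus F) (p : HeightOneSpectrum (𝓞 F)) : ℕ :=
  multiplicity p.asIdeal m.finitePart

/-- The group `U(m)` of idèles congruent to `1` modulo `m`. At a prime `p` with exponent `e` the
local condition is that `x_p` is a unit with `x_p ≡ 1 mod p ^ e` (which for `e = 0` just says that
`x_p` is a unit). At a complex place or a real place of `m` it is `x_v = 1`; at any other real place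
it is `x_v = ± 1`. -/
def Modulus.congruenceSubgroup (m : Modulus F) : Subgroup (IdeleGroup F) where
  carrier := {x |
    (∀ p : HeightOneSpectrum (𝓞 F),
      Valued.v (x.val.2 p) = 1 ∧
      Valued.v (x.val.2 p - 1) ≤ WithZero.exp (-(m.exponent p : ℤ))) ∧
    (∀ v : InfinitePlace F, v.IsComplex → x.val.1 v = 1) ∧
    (∀ v : {v : InfinitePlace F // v.IsReal}, v ∈ m.infinitePart → x.val.1 v = 1) ∧
    (∀ v : {v : InfinitePlace F // v.IsReal}, v ∉ m.infinitePart →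
      x.val.1 v = 1 ∨ x.val.1 v = -1)}
  one_mem' := by
    refine ⟨fun p => ?_, fun v _ => rfl, fun v _ => rfl, fun v _ => Or.inl rfl⟩
    have h1 : ((1 : IdeleGroup F).val.2 p) = 1 := rfl
    rw [h1]
    simp
  mul_mem' := by
    rintro x y ⟨hx1, hx2, hx3, hx4⟩ ⟨hy1, hy2, hy3, hy4⟩
    have hinf : ∀ v : InfinitePlace F, (x * y).val.1 v = x.val.1 v * y.val.1 v := fun _ => rfl
    refine ⟨fun p => ?_, fun v hv => ?_, fun v hv => ?_, fun v hv => ?_⟩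
    · have h : (x * y).val.2 p = x.val.2 p * y.val.2 p := rfl
      have h2 : x.val.2 p * y.val.2 p - 1 = x.val.2 p * (y.val.2 p - 1) + (x.val.2 p - 1) := by
        ring
      rw [h]
      refine ⟨by rw [map_mul, (hx1 p).1, (hy1 p).1, one_mul], ?_⟩
      rw [h2]
      refine Valuation.map_add_le _ ?_ (hx1 p).2
      rw [map_mul, (hx1 p).1, one_mul]
      exact (hy1 p).2
    · rw [hinf, hx2 v hv, hy2 v hv, one_mul]
    · rw [hinf, hx3 v hv, hy3 v hv, one_mul]
    · rw [hinf]
      rcases hx4 v hv with h | h <;> rcases hy4 v hv with h' | h' <;> rw [h, h'] <;> simp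
  inv_mem' := by
    rintro x ⟨hx1, hx2, hx3, hx4⟩
    have hinf : ∀ v : InfinitePlace F, x⁻¹.val.1 v * x.val.1 v = 1 := fun v =>
      congrArg (fun z : 𝔸[F] => z.1 v) x.inv_mul
    have hfin : ∀ p : HeightOneSpectrum (𝓞 F), x⁻¹.val.2 p * x.val.2 p = 1 := fun p =>
      congrArg (fun z : 𝔸[F] => z.2 p) x.inv_mul
    refine ⟨fun p => ?_, fun v hv => ?_, fun v hv => ?_, fun v hv => ?_⟩
    · have hv : Valued.v (x⁻¹.val.2 p) = 1 := by
        have h := congrArg Valued.v (hfin p)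
        rwa [map_mul, (hx1 p).1, mul_one, map_one] at h
      refine ⟨hv, ?_⟩
      have h2 : x⁻¹.val.2 p - 1 = -(x⁻¹.val.2 p * (x.val.2 p - 1)) := by
        rw [mul_sub, hfin p]; ring
      rw [h2, Valuation.map_neg, map_mul, hv, one_mul]
      exact (hx1 p).2
    · simpa [hx2 v hv] using hinf v
    · simpa [hx3 v hv] using hinf v
    · rcases hx4 v hv with h | h
      · left; simpa [h] using hinf v
      · right
        have h' := hinf v
        rw [h, mul_neg, mul_one] at h'
        rw [← h', neg_neg]

/-- The group of Hecke characters of modulus `m`: those trivial on `U(m)`. -/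
def charactersOfModulus (m : Modulus F) : Subgroup (HeckeCharacter F) where
  carrier := {χ | ∀ x ∈ m.congruenceSubgroup, evalIdele χ x = 1}
  one_mem' := fun _ _ => rfl
  mul_mem' := by
    intro χ ψ hχ hψ x hx
    have h : evalIdele (χ * ψ) x = evalIdele χ x * evalIdele ψ x := rfl
    rw [h, hχ x hx, hψ x hx, one_mul]
  inv_mem' := by
    intro χ hχ x hx
    have h : evalIdele χ⁻¹ x = (evalIdele χ x)⁻¹ := rfl
    rw [h, hχ x hx, inv_one]

/-- The embedded copy of `ℝ_{>0}` in the idèles: idèles with finite part `1` whose archimedean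
components are all equal to one positive real number. -/
def positiveRealIdeles (F : Type*) [Field F] [NumberField F] : Set (IdeleGroup F) :=
  {x | x.val.2 = 1 ∧ ∃ t : ℝ, 0 < t ∧
    ∀ v : InfinitePlace F, InfinitePlace.Completion.extensionEmbedding v (x.val.1 v) = (t : ℂ)}

/-- Hecke characters trivial on the embedded `ℝ_{>0}`. Under `C_F ≅ C_F¹ × ℝ_{>0}` this is the
character group of the norm-one idèle class group `C_F¹`. -/
def normalizedCharacters (F : Type*) [Field F] [NumberField F] : Subgroup (HeckeCharacter F) where
  carrier := {χ | ∀ x ∈ positiveRealIdeles F, evalIdele χ x = 1}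
  one_mem' := fun _ _ => rfl
  mul_mem' := by
    intro χ ψ hχ hψ x hx
    have h : evalIdele (χ * ψ) x = evalIdele χ x * evalIdele ψ x := rfl
    rw [h, hχ x hx, hψ x hx, one_mul]
  inv_mem' := by
    intro χ hχ x hx
    have h : evalIdele χ⁻¹ x = (evalIdele χ x)⁻¹ := rfl
    rw [h, hχ x hx, inv_one]

open scoped Classical in
/-- The idèle with component `x` at the infinite place `w` and `1` at all other places. -/
def archimedeanIdele (w : InfinitePlace F) : (w.Completion)ˣ →* IdeleGroup F :=
  Units.map
    { toFun := fun x => ((Pi.mulSingle w x, 1) : InfiniteAdeleRing F × FiniteAdeleRing (𝓞 F) F)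
      map_one' := Prod.ext (Pi.mulSingle_one w) rfl
      map_mul' := fun x y => Prod.ext (Pi.mulSingle_mul w x y) (one_mul _).symm }

/-- `(k, φ)` are the local parameters of `χ` at the infinite place `w`: the local component is
`χ_w(z) = (z / |z|) ^ k * |z| ^ (i n_w φ)`, where `n_w = [F_w : ℝ]`. At a real place
`z / |z|` is the sign of `z`, and `k` is taken in `{0, 1}`. -/
def HasLocalParameters (χ : HeckeCharacter F) (w : InfinitePlace F) (k : ℤ) (φ : ℝ) : Prop :=
  (w.IsReal → k = 0 ∨ k = 1) ∧
  ∀ x : (w.Completion)ˣ,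
    let z : ℂ := InfinitePlace.Completion.extensionEmbedding w x.val
    (evalIdele χ (archimedeanIdele w x) : ℂ) =
      (z / (‖z‖ : ℂ)) ^ k * (‖z‖ : ℂ) ^ (Complex.I * (w.mult : ℂ) * (φ : ℂ))

/-- The real places of `F₀` that become complex in `F`. -/
def ramifiedRealPlaces (F₀ F : Type*) [Field F₀] [Field F] [Algebra F₀ F] :
    Set (InfinitePlace F₀) :=
  {v | v.IsReal ∧ ∃ w : InfinitePlace F, w.comap (algebraMap F₀ F) = v ∧ w.IsComplex}

end HeckeChar

end

noncomputable section

namespace HeckeChar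

open NumberField IsDedekindDomain

/-! ### Extending characters with values in the circle -/

/-! Let `σ` generate the Galois group of `F/F₀`. A unitary character of the archimedean components,
of type `(k, φ)`, extends to a Hecke character unramified at every finite place as soon as it kills
the global units (`exists_heckeCharacter`): on the open subgroup of idèles with unit finite
components it is well defined modulo principal idèles, and the circle is divisible. If moreover `k =
0` at the real places and `∑ φ_w = 0`, the result is trivial on every `U(m)` and on the positive
reals, so the modulus plays no role.

The types come from characters `x ↦ ψ (x / σ x)`. Their `φ` is antisymmetric under the action of `σ`
on places, so it sums to zero and vanishes at every fixed place. Complex places above real places of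
`F₀` are fixed, which gives the required vanishing. It remains to make `ψ` trivial on the units `u /
σ u`. Let `P` contain one place from each two-element orbit. By Dirichlet's theorem the logarithms
of the `u / σ u` at `P` form a full lattice in `ℝ ^ P` (`discreteTopology_antiLattice`,
`span_antiLattice`), with kernel consisting of roots of unity. For any `k`, a `φ` supported on `P`
can therefore be solved for so that `ψ` is trivial on a lattice basis; the torsion order disposes of
the roots of unity.

The free parameters are an integer `k_w` at each complex place that is fixed or in `P`, and an
element of `2π` times the dual lattice, of rank `|P|`. Their number is half the sum of the local
degrees, that is `[F : ℚ] / 2 = [F₀ : ℚ]` (`two_mul_card_eq_finrank`). -/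

instance circleDivisibleBy : DivisibleBy (Additive Circle) ℤ where
  div z n := Additive.ofMul (Circle.exp ((z.toMul : ℂ).arg / n))
  div_zero z := by simp
  div_cancel {n} z hn := by
    have hn' : (n : ℝ) ≠ 0 := Int.cast_ne_zero.2 hn
    have h : Circle.expHom (n • ((z.toMul : ℂ).arg / n)) = z := by
      rw [zsmul_eq_mul, mul_div_cancel₀ _ hn']
      exact Circle.exp_arg z.toMul
    rw [map_zsmul] at h
    exact h

/-- A character of a commutative group agrees on a subgroup `V` with a character trivial on a given
subgroup `N`, as soon as it is trivial on `N ∩ V`. -/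
theorem exists_circle_extension {G : Type*} [CommGroup G] (N V : Subgroup G) (f : G →* Circle)
    (hf : ∀ x ∈ N, x ∈ V → f x = 1) :
    ∃ g : G →* Circle, (∀ x ∈ N, g x = 1) ∧ ∀ x ∈ V, g x = f x := by
  let M : Subgroup V := N.subgroupOf V
  have hM : M ≤ (f.comp V.subtype).ker := fun x hx => hf x.1 hx x.2
  let f' : V ⧸ M →* Circle := QuotientGroup.lift M (f.comp V.subtype) hM
  let i : V ⧸ M →* G ⧸ N := QuotientGroup.map M N V.subtype le_rfl
  have hi : Function.Injective i := by
    rw [injective_iff_map_eq_one]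
    intro x
    induction x using QuotientGroup.induction_on with
    | H x =>
      intro hx
      have h : (QuotientGroup.mk (x : G) : G ⧸ N) = 1 := hx
      rw [QuotientGroup.eq_one_iff] at h
      exact (QuotientGroup.eq_one_iff _).2 h
  -- Divisible abelian groups are injective, so the character of `V / (N ∩ V)` extends along its
  -- embedding in `G / N`.
  obtain ⟨h, hh⟩ := (Module.Baer.of_divisible (Additive Circle)).extension_property_addMonoidHom
    (MonoidHom.toAdditive i) hi (MonoidHom.toAdditive f')
  let h' : G ⧸ N →* Circle := MonoidHom.toAdditive.symm h
  refine ⟨h'.comp (QuotientGroup.mk' N), ?_, ?_⟩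
  · intro x hx
    have : QuotientGroup.mk' N x = 1 := (QuotientGroup.eq_one_iff x).2 hx
    rw [MonoidHom.comp_apply, this, map_one]
  · intro x hx
    exact DFunLike.congr_fun hh (Additive.ofMul (QuotientGroup.mk (⟨x, hx⟩ : V) : V ⧸ M))

/-! ### Characters of a product of copies of `ℂˣ` -/

/-- The angular component `z / |z|` of a nonzero complex number. -/
def phase : ℂˣ →* Circle where
  toFun z := ⟨(z : ℂ) / (‖(z : ℂ)‖ : ℂ), mem_sphere_zero_iff_norm.2 (by simp)⟩
  map_one' := by ext; simp
  map_mul' x y := by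
    ext
    change ((x * y : ℂˣ) : ℂ) / (‖((x * y : ℂˣ) : ℂ)‖ : ℂ) =
      x / (‖(x : ℂ)‖ : ℂ) * (y / (‖(y : ℂ)‖ : ℂ))
    rw [Units.val_mul, norm_mul, Complex.ofReal_mul, mul_div_mul_comm]

theorem coe_phase (z : ℂˣ) : (phase z : ℂ) = (z : ℂ) / (‖(z : ℂ)‖ : ℂ) := rfl

theorem continuous_phase : Continuous phase := by
  refine Continuous.subtype_mk ?_ _
  refine Continuous.div Units.continuous_val (by fun_prop) ?_
  intro z
  simp

theorem phase_of_pos {z : ℂˣ} {t : ℝ} (ht : 0 < t) (hz : (z : ℂ) = t) : phase z = 1 := by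
  ext
  rw [coe_phase, hz, Complex.norm_real, Real.norm_of_nonneg ht.le, Circle.coe_one, div_self]
  exact_mod_cast ht.ne'

section TorusChar

variable {X : Type*} [Fintype X]

/-- The character `z ↦ ∏ (z_w / |z_w|) ^ k_w |z_w| ^ (i φ_w)` attached to `(k, φ)`, as a homomorphism
in `(k, φ)`. -/
def torusChar : (X → ℤ) × (X → ℝ) →+ Additive ((X → ℂˣ) →* Circle) where
  toFun τ := Additive.ofMul
    { toFun := fun z => (∏ w, phase (z w) ^ τ.1 w) *
        Circle.exp (∑ w, τ.2 w * Real.log ‖(z w : ℂ)‖)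
      map_one' := by simp
      map_mul' := fun x y => by
        have h : ∀ w, Real.log ‖((x * y) w : ℂ)‖ = Real.log ‖(x w : ℂ)‖ + Real.log ‖(y w : ℂ)‖ :=
          fun w => by
            rw [Pi.mul_apply, Units.val_mul, norm_mul, Real.log_mul (by simp) (by simp)]
        simp only [h, mul_add, Finset.sum_add_distrib, Circle.exp_add]
        simp only [Pi.mul_apply, map_mul, mul_zpow, Finset.prod_mul_distrib]
        exact mul_mul_mul_comm (_ : Circle) _ _ _ }
  map_zero' := by
    apply Additive.toMul.injective
    ext
    simp
  map_add' τ τ' := by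
    apply Additive.toMul.injective
    refine MonoidHom.ext fun z => ?_
    change (∏ w, phase (z w) ^ (τ.1 w + τ'.1 w)) *
      Circle.exp (∑ w, (τ.2 w + τ'.2 w) * Real.log ‖(z w : ℂ)‖) = _ * _ * (_ * _)
    simp only [zpow_add, add_mul, Finset.sum_add_distrib, Circle.exp_add, Finset.prod_mul_distrib]
    exact mul_mul_mul_comm (_ : Circle) _ _ _

theorem torusChar_apply (τ : (X → ℤ) × (X → ℝ)) (z : X → ℂˣ) :
    (torusChar τ).toMul z = (∏ w, phase (z w) ^ τ.1 w) *
      Circle.exp (∑ w, τ.2 w * Real.log ‖(z w : ℂ)‖) := rfl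

theorem continuous_torusChar (τ : (X → ℤ) × (X → ℝ)) : Continuous (torusChar τ).toMul := by
  change Continuous fun z : X → ℂˣ => (∏ w, phase (z w) ^ τ.1 w) *
      Circle.exp (∑ w, τ.2 w * Real.log ‖(z w : ℂ)‖)
  refine Continuous.mul ?_ ?_
  · exact continuous_finsetProd _ fun w _ =>
      (continuous_phase.comp (continuous_apply w)).zpow (τ.1 w)
  · refine Circle.exp.continuous.comp (continuous_finsetSum _ fun w _ => continuous_const.mul ?_)
    refine Continuous.log ?_ (fun z => by simp)
    exact (Units.continuous_val.comp (continuous_apply w)).norm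

theorem torusChar_add_apply (τ τ' : (X → ℤ) × (X → ℝ)) (z : X → ℂˣ) :
    (torusChar (τ + τ')).toMul z = (torusChar τ).toMul z * (torusChar τ').toMul z := by
  rw [map_add]; rfl

theorem torusChar_sum_zsmul_apply {ι : Type*} [Fintype ι] (n : ι → ℤ)
    (τ : ι → (X → ℤ) × (X → ℝ)) (z : X → ℂˣ) :
    (torusChar (∑ i, n i • τ i)).toMul z = ∏ i, (torusChar (τ i)).toMul z ^ n i := by
  rw [map_sum, toMul_sum, MonoidHom.finsetProd_apply]
  refine Finset.prod_congr rfl fun i _ => ?_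
  rw [map_zsmul, toMul_zsmul, MonoidHom.zpow_apply]

theorem torusChar_mulSingle [DecidableEq X] (τ : (X → ℤ) × (X → ℝ)) (w : X) (z : ℂˣ) :
    (torusChar τ).toMul (Pi.mulSingle w z) =
      phase z ^ τ.1 w * Circle.exp (τ.2 w * Real.log ‖(z : ℂ)‖) := by
  rw [torusChar_apply]
  congr 1
  · rw [Finset.prod_eq_single w (fun v _ hv => by rw [Pi.mulSingle_eq_of_ne hv]; simp) (by simp),
      Pi.mulSingle_eq_same]
  · rw [Finset.sum_eq_single w (fun v _ hv => by rw [Pi.mulSingle_eq_of_ne hv]; simp) (by simp),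
      Pi.mulSingle_eq_same]

end TorusChar

theorem eq_zero_of_forall_exp_mul_eq_one {a : ℝ} (h : ∀ t : ℝ, Circle.exp (a * t) = 1) : a = 0 := by
  by_contra ha
  -- At this `t` the value would be `-1`.
  have h1 := h (Real.pi / a)
  rw [mul_div_cancel₀ _ ha] at h1
  have := congrArg (fun z : Circle => (z : ℂ)) h1
  rw [Circle.coe_exp, Complex.exp_pi_mul_I] at this
  norm_num at this

theorem eq_zero_of_forall_exp_zpow_eq_one {k : ℤ} (h : ∀ t : ℝ, Circle.exp t ^ k = 1) : k = 0 := by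
  have : (k : ℝ) = 0 := eq_zero_of_forall_exp_mul_eq_one fun t => by
    rw [← h t]
    have : Circle.expHom (k • t) = k • Circle.expHom t := map_zsmul _ _ _
    rw [zsmul_eq_mul] at this
    exact this
  exact_mod_cast this

section IdeleCharacters

variable {F : Type*} [Field F] [NumberField F]

/-! ### Hecke characters with prescribed archimedean components -/

/-- The projection of an idèle to its component at an infinite place, seen in `ℂ`. -/
def adeleComponent (w : InfinitePlace F) : 𝔸[F] →* ℂ where
  toFun x := InfinitePlace.Completion.extensionEmbedding w (x.1 w)
  map_one' := map_one (InfinitePlace.Completion.extensionEmbedding w)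
  map_mul' x y := map_mul (InfinitePlace.Completion.extensionEmbedding w) (x.1 w) (y.1 w)

theorem continuous_adeleComponent (w : InfinitePlace F) : Continuous (adeleComponent w) := by
  refine (InfinitePlace.Completion.isometry_extensionEmbedding w).continuous.comp ?_
  exact (continuous_apply w).comp continuous_fst

/-- The archimedean components of an idèle. -/
def archComponents : IdeleGroup F →* (InfinitePlace F → ℂˣ) :=
  MonoidHom.mk' (fun x w => Units.map (adeleComponent w) x) fun x y =>
    funext fun w => map_mul (Units.map (adeleComponent w)) x y

theorem archComponents_apply (x : IdeleGroup F) (w : InfinitePlace F) :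
    (archComponents x w : ℂ) = InfinitePlace.Completion.extensionEmbedding w (x.val.1 w) := rfl

theorem continuous_archComponents : Continuous (archComponents (F := F)) :=
  continuous_pi fun w => (continuous_adeleComponent w).units_map _

/-- The images of a nonzero element of `F` in `ℂ`, one for each infinite place. -/
def embeddings : Fˣ →* (InfinitePlace F → ℂˣ) :=
  MonoidHom.mk' (fun x w => Units.map w.embedding.toMonoidHom x) fun x y =>
    funext fun w => map_mul (Units.map w.embedding.toMonoidHom) x y

omit [NumberField F] in
theorem embeddings_apply (x : Fˣ) (w : InfinitePlace F) :
    (embeddings x w : ℂ) = w.embedding x := rfl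

theorem archComponents_principal (x : Fˣ) :
    archComponents (Units.map (algebraMap F 𝔸[F]).toMonoidHom x) = embeddings x := by
  ext w
  rw [archComponents_apply, embeddings_apply]
  exact InfinitePlace.Completion.extensionEmbedding_coe w _

open scoped Classical in
theorem archComponents_archimedeanIdele (w : InfinitePlace F) (x : (w.Completion)ˣ) :
    archComponents (archimedeanIdele w x) = Pi.mulSingle w
      (Units.map (InfinitePlace.Completion.extensionEmbedding w).toMonoidHom x) := by
  ext v
  rw [archComponents_apply]
  change InfinitePlace.Completion.extensionEmbedding v
    ((Pi.mulSingle w x.val : InfiniteAdeleRing F) v) = _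
  by_cases h : v = w
  · subst h
    rw [Pi.mulSingle_eq_same, Pi.mulSingle_eq_same]
    rfl
  · rw [Pi.mulSingle_eq_of_ne h, Pi.mulSingle_eq_of_ne h, map_one]
    rfl

theorem finiteComponent_inv_mul (x : IdeleGroup F) (p : HeightOneSpectrum (𝓞 F)) :
    x⁻¹.val.2 p * x.val.2 p = 1 :=
  congrArg (fun z : 𝔸[F] => z.2 p) x.inv_mul

variable (F) in
/-- The idèles all of whose finite components are units. -/
def integralIdeles : Subgroup (IdeleGroup F) where
  carrier := {x | ∀ p : HeightOneSpectrum (𝓞 F), Valued.v (x.val.2 p) = 1}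
  one_mem' := fun p => by
    have h : (1 : IdeleGroup F).val.2 p = 1 := rfl
    rw [h, map_one]
  mul_mem' := fun {x y} hx hy p => by
    have h : (x * y).val.2 p = x.val.2 p * y.val.2 p := rfl
    rw [h, map_mul, hx p, hy p, one_mul]
  inv_mem' := fun {x} hx p => by
    have h := congrArg Valued.v (finiteComponent_inv_mul x p)
    rwa [map_mul, hx p, mul_one, map_one] at h

/-- Unit components mean that both `x` and `x⁻¹` are integral, and integrality is open in the
restricted product. -/
theorem isOpen_integralIdeles : IsOpen (integralIdeles F : Set (IdeleGroup F)) := by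
  have hO : IsOpen {a : FiniteAdeleRing (𝓞 F) F |
      ∀ p : HeightOneSpectrum (𝓞 F), a p ∈ p.adicCompletionIntegers F} :=
    RestrictedProduct.isOpen_forall_mem fun _ => Valued.isOpen_valuationSubring _
  have h1 : Continuous fun x : IdeleGroup F => x.val.2 :=
    continuous_snd.comp Units.continuous_val
  have h2 : Continuous fun x : IdeleGroup F => x⁻¹.val.2 := h1.comp continuous_inv
  convert (hO.preimage h1).inter (hO.preimage h2) using 1
  ext x
  constructor
  · intro hx
    exact ⟨fun p => (hx p).le, fun p => ((integralIdeles F).inv_mem hx p).le⟩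
  · rintro ⟨ha, hb⟩ p
    refine le_antisymm (ha p) ?_
    have h := congrArg Valued.v (finiteComponent_inv_mul x p)
    rw [map_mul, map_one] at h
    rw [← h]
    exact mul_le_of_le_one_left' (hb p)

/-- A principal idèle with unit finite components comes from a unit of the ring of integers. -/
theorem exists_unit_of_mem_integralIdeles {x : Fˣ}
    (hx : Units.map (algebraMap F 𝔸[F]).toMonoidHom x ∈ integralIdeles F) :
    ∃ u : (𝓞 F)ˣ, Units.map (algebraMap (𝓞 F) F).toMonoidHom u = x := by
  have key : ∀ y : Fˣ, Units.map (algebraMap F 𝔸[F]).toMonoidHom y ∈ integralIdeles F →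
      ∃ a : 𝓞 F, algebraMap (𝓞 F) F a = y := fun y hy => by
    refine HeightOneSpectrum.mem_integers_of_valuation_le_one F (y : F) fun p => ?_
    rw [← HeightOneSpectrum.valuedAdicCompletion_eq_valuation']
    exact (hy p).le
  obtain ⟨a, ha⟩ := key x hx
  obtain ⟨b, hb⟩ := key x⁻¹ (by rw [map_inv]; exact inv_mem hx)
  have hab : a * b = 1 := by
    apply FaithfulSMul.algebraMap_injective (𝓞 F) F
    rw [map_mul, ha, hb, map_one, Units.mul_inv]
  exact ⟨⟨a, b, hab, by rw [mul_comm, hab]⟩, Units.ext ha⟩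

/-- A character of the archimedean components which is trivial on the global units extends to a
Hecke character unramified at all finite places. -/
theorem exists_heckeCharacter (f : (InfinitePlace F → ℂˣ) →* Circle) (hf : Continuous f)
    (hu : ∀ u : (𝓞 F)ˣ, f (embeddings (Units.map (algebraMap (𝓞 F) F).toMonoidHom u)) = 1) :
    ∃ χ : HeckeCharacter F, ∀ x ∈ integralIdeles F, evalIdele χ x = f (archComponents x) := by
  obtain ⟨g, hgN, hgV⟩ := exists_circle_extension (principalIdeles F) (integralIdeles F)
    (f.comp archComponents) (by
      rintro _ ⟨y, rfl⟩ hy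
      obtain ⟨u, rfl⟩ := exists_unit_of_mem_integralIdeles hy
      rw [MonoidHom.comp_apply, archComponents_principal, hu])
  -- The extension is purely algebraic, but near `1` it coincides with the continuous `f ∘
  -- archComponents`, because the integral idèles are open.
  have hg : Continuous g := by
    refine continuous_of_continuousAt_one g ?_
    have h : ContinuousAt (fun x => f (archComponents x)) (1 : IdeleGroup F) :=
      (hf.comp continuous_archComponents).continuousAt
    refine h.congr ?_
    filter_upwards [isOpen_integralIdeles.mem_nhds (integralIdeles F).one_mem] with x hx
    exact (hgV x hx).symm
  exact ⟨{ toMonoidHom := QuotientGroup.lift (principalIdeles F) g hgN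
           continuous_toFun := hg.quotient_lift _ }, fun x hx => hgV x hx⟩

theorem evalIdele_prod_zpow {ι : Type*} [Fintype ι] (χ : ι → HeckeCharacter F) (n : ι → ℤ)
    (x : IdeleGroup F) : evalIdele (∏ i, χ i ^ n i) x = ∏ i, evalIdele (χ i) x ^ n i := by
  let ev : HeckeCharacter F →* Circle := MonoidHom.mk' (fun χ => evalIdele χ x) fun _ _ => rfl
  change ev (∏ i, χ i ^ n i) = ∏ i, ev (χ i) ^ n i
  simp only [map_prod, map_zpow]

theorem congruenceSubgroup_le_integralIdeles (m : Modulus F) :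
    m.congruenceSubgroup ≤ integralIdeles F := fun _ hx p => (hx.1 p).1

theorem archimedeanIdele_mem_integralIdeles (w : InfinitePlace F) (x : (w.Completion)ˣ) :
    archimedeanIdele w x ∈ integralIdeles F := fun p => by
  have h : (archimedeanIdele w x).val.2 p = 1 := rfl
  rw [h, map_one]

theorem positiveRealIdeles_subset_integralIdeles :
    positiveRealIdeles F ⊆ integralIdeles F := fun x hx p => by
  have h : x.val.2 p = 1 := by rw [hx.1]; rfl
  rw [h, map_one]

/-- `(k, φ)` is an admissible archimedean type if the character attached to it is trivial on units, on
positive reals, and on signs at the real places. -/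
structure IsUnitType (τ : (InfinitePlace F → ℤ) × (InfinitePlace F → ℝ)) : Prop where
  units : ∀ u : (𝓞 F)ˣ,
    (torusChar τ).toMul (embeddings (Units.map (algebraMap (𝓞 F) F).toMonoidHom u)) = 1
  real : ∀ w : InfinitePlace F, w.IsReal → τ.1 w = 0
  sum : ∑ w, τ.2 w = 0

/-- All archimedean components are `±1`, so `φ` contributes nothing; the value `-1` occurs only at
real places, where `k = 0`. -/
theorem IsUnitType.eq_one_of_mem_congruenceSubgroup
    {τ : (InfinitePlace F → ℤ) × (InfinitePlace F → ℝ)} (hτ : IsUnitType τ) {m : Modulus F}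
    {x : IdeleGroup F} (hx : x ∈ m.congruenceSubgroup) :
    (torusChar τ).toMul (archComponents x) = 1 := by
  have hx' : ∀ w : InfinitePlace F, x.val.1 w = 1 ∨ (w.IsReal ∧ x.val.1 w = -1) := fun w => by
    rcases w.isReal_or_isComplex with hw | hw
    · by_cases hm : ⟨w, hw⟩ ∈ m.infinitePart
      · exact Or.inl (hx.2.2.1 ⟨w, hw⟩ hm)
      · exact (hx.2.2.2 ⟨w, hw⟩ hm).imp id fun h => ⟨hw, h⟩
    · exact Or.inl (hx.2.1 w hw)
  have hnorm : ∀ w, ‖(archComponents x w : ℂ)‖ = 1 := fun w => by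
    rw [archComponents_apply]
    rcases hx' w with h | ⟨-, h⟩ <;> simp [h]
  rw [torusChar_apply, Finset.prod_eq_one, one_mul]
  · simp [hnorm]
  · intro w _
    rcases hx' w with h | ⟨hw, -⟩
    · rw [phase_of_pos one_pos, one_zpow]
      rw [archComponents_apply, h, map_one, Complex.ofReal_one]
    · rw [hτ.real w hw, zpow_zero]

theorem IsUnitType.eq_one_of_mem_positiveRealIdeles
    {τ : (InfinitePlace F → ℤ) × (InfinitePlace F → ℝ)} (hτ : IsUnitType τ)
    {x : IdeleGroup F} (hx : x ∈ positiveRealIdeles F) :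
    (torusChar τ).toMul (archComponents x) = 1 := by
  obtain ⟨-, t, ht, hxt⟩ := hx
  have hnorm : ∀ w, ‖(archComponents x w : ℂ)‖ = t := fun w => by
    rw [archComponents_apply, hxt, Complex.norm_real, Real.norm_of_nonneg ht.le]
  rw [torusChar_apply, Finset.prod_eq_one, one_mul]
  · simp [hnorm, ← Finset.sum_mul, hτ.sum]
  · intro w _
    rw [phase_of_pos ht (hxt w), one_zpow]

open scoped Classical in
/-- The type of a character of `∏ F_wˣ` is determined by the character, once `k_w = 0` at real `w`. -/
theorem eq_zero_of_torusChar_archimedeanIdele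
    {τ : (InfinitePlace F → ℤ) × (InfinitePlace F → ℝ)}
    (hreal : ∀ w : InfinitePlace F, w.IsReal → τ.1 w = 0)
    (h : ∀ (w : InfinitePlace F) (x : (w.Completion)ˣ),
      (torusChar τ).toMul (archComponents (archimedeanIdele w x)) = 1) : τ = 0 := by
  have key : ∀ (w : InfinitePlace F) (z : ℂˣ),
      (∃ a : w.Completion, InfinitePlace.Completion.extensionEmbedding w a = z) →
      phase z ^ τ.1 w * Circle.exp (τ.2 w * Real.log ‖(z : ℂ)‖) = 1 := by
    rintro w z ⟨a, ha⟩
    have ha0 : a ≠ 0 := by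
      rintro rfl
      exact z.ne_zero (by rw [← ha, map_zero])
    have := h w (Units.mk0 a ha0)
    rw [archComponents_archimedeanIdele, torusChar_mulSingle] at this
    have hz : Units.map (InfinitePlace.Completion.extensionEmbedding w).toMonoidHom
        (Units.mk0 a ha0) = z := Units.ext ha
    rwa [hz] at this
  -- Positive reals `e ^ t` have trivial phase and so isolate `φ_w`; afterwards the unit circle at a
  -- complex place isolates `k_w`.
  have hφ : ∀ w, τ.2 w = 0 := fun w => by
    refine eq_zero_of_forall_exp_mul_eq_one fun t => ?_
    let z : ℂˣ := Units.mk0 ((Real.exp t : ℝ) : ℂ) (by exact_mod_cast (Real.exp_pos t).ne')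
    have hz : (z : ℂ) = (Real.exp t : ℝ) := rfl
    have := key w z (by
      rcases w.isReal_or_isComplex with hw | hw
      · obtain ⟨a, ha⟩ :=
          InfinitePlace.Completion.surjective_extensionEmbeddingOfIsReal hw (Real.exp t)
        exact ⟨a, by rw [← InfinitePlace.Completion.extensionEmbeddingOfIsReal_apply hw, ha, hz]⟩
      · exact InfinitePlace.Completion.surjective_extensionEmbedding_of_isComplex hw _)
    rwa [phase_of_pos (Real.exp_pos t) hz, one_zpow, one_mul, hz, Complex.norm_real,
      Real.norm_of_nonneg (Real.exp_pos t).le, Real.log_exp] at this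
  refine Prod.ext (funext fun w => ?_) (funext hφ)
  rcases w.isReal_or_isComplex with hw | hw
  · exact hreal w hw
  · refine eq_zero_of_forall_exp_zpow_eq_one fun t => ?_
    have := key w (Circle.toUnits (Circle.exp t))
      (InfinitePlace.Completion.surjective_extensionEmbedding_of_isComplex hw _)
    rw [hφ w, zero_mul, Circle.exp_zero, mul_one] at this
    convert this using 2
    ext
    rw [coe_phase]
    simp

universe u

/-- Linearly independent admissible types give a free group of Hecke characters unramified at all
finite places. -/
theorem exists_subgroup_of_isUnitType {F ι : Type u} [Field F] [NumberField F] [Fintype ι]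
    (τ : ι → (InfinitePlace F → ℤ) × (InfinitePlace F → ℝ)) (hli : LinearIndependent ℤ τ)
    (hτ : ∀ i, IsUnitType (τ i)) (m : Modulus F) :
    ∃ H : Subgroup (HeckeCharacter F),
      H ≤ charactersOfModulus m ∧ H ≤ normalizedCharacters F ∧
      Module.rank ℤ (Additive H) = Fintype.card ι ∧
      ∀ χ ∈ H, ∀ w : InfinitePlace F, w.IsComplex → (∀ i, (τ i).2 w = 0) →
        ∃ k : ℤ, HasLocalParameters χ w k 0 := by
  classical
  choose χ hχ using fun i => exists_heckeCharacter (torusChar (τ i)).toMul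
    (continuous_torusChar (τ i)) (hτ i).units
  let Ξ : Multiplicative (ι → ℤ) →* HeckeCharacter F := MonoidHom.mk'
    (fun n => ∏ i, χ i ^ n.toAdd i) fun n n' => by
      simp [zpow_add, Finset.prod_mul_distrib]
  have hev : ∀ (n : Multiplicative (ι → ℤ)), ∀ x ∈ integralIdeles F,
      evalIdele (Ξ n) x = (torusChar (∑ i, n.toAdd i • τ i)).toMul (archComponents x) := by
    intro n x hx
    rw [torusChar_sum_zsmul_apply]
    refine (evalIdele_prod_zpow χ n.toAdd x).trans ?_
    exact Finset.prod_congr rfl fun i _ => by rw [hχ i x hx]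
  have hev' : ∀ (n : Multiplicative (ι → ℤ)), ∀ x ∈ integralIdeles F,
      (∀ i, (torusChar (τ i)).toMul (archComponents x) = 1) → evalIdele (Ξ n) x = 1 := by
    intro n x hx h
    rw [hev n x hx, torusChar_sum_zsmul_apply]
    exact Finset.prod_eq_one fun i _ => by rw [h i, one_zpow]
  have hinj : Function.Injective Ξ := by
    rw [injective_iff_map_eq_one]
    intro n hn
    -- The trivial Hecke character is trivial on idèles supported at one infinite place, and these
    -- determine the type.
    have h0 : ∑ i, n.toAdd i • τ i = 0 := by
      refine eq_zero_of_torusChar_archimedeanIdele (fun w hw => ?_) fun w x => ?_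
      · simp [Prod.fst_sum, (hτ _).real w hw]
      · rw [← hev n _ (archimedeanIdele_mem_integralIdeles w x), hn]
        rfl
    exact funext fun i => Fintype.linearIndependent_iff.1 hli _ h0 i
  refine ⟨Ξ.range, ?_, ?_, ?_, ?_⟩
  · rintro _ ⟨n, rfl⟩ x hx
    exact hev' n x (congruenceSubgroup_le_integralIdeles m hx) fun i =>
      (hτ i).eq_one_of_mem_congruenceSubgroup hx
  · rintro _ ⟨n, rfl⟩ x hx
    exact hev' n x (positiveRealIdeles_subset_integralIdeles hx) fun i =>
      (hτ i).eq_one_of_mem_positiveRealIdeles hx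
  · let e : (ι → ℤ) ≃+ Additive Ξ.range :=
      (AddEquiv.refl _ : (ι → ℤ) ≃+ Additive (Multiplicative (ι → ℤ))).trans
        (MulEquiv.toAdditive (MonoidHom.ofInjective hinj))
    rw [← e.toIntLinearEquiv.rank_eq, rank_fun']
  · rintro _ ⟨n, rfl⟩ w hw h0
    refine ⟨(∑ i, n.toAdd i • τ i).1 w, fun hr => ?_, fun x => ?_⟩
    · exact absurd hr (InfinitePlace.not_isReal_iff_isComplex.2 hw)
    · have hφ : (∑ i, n.toAdd i • τ i).2 w = 0 := by
        simp [Prod.snd_sum, h0]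
      rw [hev n _ (archimedeanIdele_mem_integralIdeles w x), archComponents_archimedeanIdele,
        torusChar_mulSingle, hφ]
      simp [coe_phase]

end IdeleCharacters

/-! ### The logarithmic lattice of the units `u / σ u` -/

section AntiUnits

variable {F : Type*} [Field F] [NumberField F]

/-- A linear form in the logarithms of units which vanishes on all units is a multiple of the
logarithm of the norm. -/
theorem exists_eq_mul_mult_of_sum_log_eq_zero (C : InfinitePlace F → ℝ)
    (hC : ∀ u : (𝓞 F)ˣ, ∑ w, C w * Real.log (w (u : F)) = 0) :
    ∃ t : ℝ, ∀ w, C w = t * w.mult := by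
  -- With `t` the minimum of `C w / w.mult`, the coefficients `C w - t * w.mult` are nonnegative. A
  -- unit of absolute value `< 1` away from `w₁` then makes every term of a vanishing sum
  -- nonpositive, so each of these coefficients is zero.
  obtain ⟨w₁, hw₁⟩ := Finite.exists_min fun w : InfinitePlace F => C w / w.mult
  refine ⟨C w₁ / w₁.mult, ?_⟩
  obtain ⟨u, hu⟩ := Units.dirichletUnitTheorem.exists_unit F w₁
  have hle : ∀ w, C w₁ / w₁.mult * w.mult ≤ C w := fun w => by
    have := hw₁ w
    rwa [le_div_iff₀ (by exact_mod_cast InfinitePlace.mult_pos)] at this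
  have h0 : ∑ w : InfinitePlace F, (C w - C w₁ / w₁.mult * w.mult) * Real.log (w (u : F)) = 0 := by
    simp only [sub_mul, Finset.sum_sub_distrib, hC u, mul_assoc, ← Finset.mul_sum,
      Units.sum_mult_mul_log, mul_zero, sub_zero]
  have hterm : ∀ w ∈ Finset.univ,
      (C w - C w₁ / w₁.mult * w.mult) * Real.log (w (u : F)) ≤ 0 := fun w _ => by
    by_cases h : w = w₁
    · subst h
      rw [div_mul_cancel₀ _ InfinitePlace.mult_coe_ne_zero, sub_self, zero_mul]
    · exact mul_nonpos_of_nonneg_of_nonpos (sub_nonneg.2 (hle w)) (hu w h).le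
  intro w
  by_cases h : w = w₁
  · subst h
    rw [div_mul_cancel₀ _ InfinitePlace.mult_coe_ne_zero]
  · have := (Finset.sum_eq_zero_iff_of_nonpos hterm).1 h0 w (Finset.mem_univ w)
    rcases mul_eq_zero.1 this with h' | h'
    · exact sub_eq_zero.1 h'
    · exact absurd h' (hu w h).ne

/-- The place `x ↦ |σ x|_w`. -/
def conjPlace (σ : F ≃+* F) (w : InfinitePlace F) : InfinitePlace F := w.comap (σ : F →+* F)

omit [NumberField F] in
theorem conjPlace_apply (σ : F ≃+* F) (w : InfinitePlace F) (x : F) :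
    conjPlace σ w x = w (σ x) := rfl

omit [NumberField F] in
theorem conjPlace_involutive {σ : F ≃+* F} (hσ : Function.Involutive σ) :
    Function.Involutive (conjPlace σ) := fun w =>
  InfinitePlace.ext _ _ fun x => by rw [conjPlace_apply, conjPlace_apply, hσ x]

omit [NumberField F] in
theorem isComplex_conjPlace_iff (σ : F ≃+* F) (w : InfinitePlace F) :
    (conjPlace σ w).IsComplex ↔ w.IsComplex := by
  rw [← InfinitePlace.not_isReal_iff_isComplex, ← InfinitePlace.not_isReal_iff_isComplex]
  exact not_congr (InfinitePlace.isReal_comap_iff σ)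

/-- The quotient `u / σ u` of a unit by its conjugate. -/
def antiUnit (σ : F ≃+* F) : (𝓞 F)ˣ →* (𝓞 F)ˣ :=
  MonoidHom.id _ / Units.map (RingOfIntegers.mapRingHom (σ : F →+* F)).toMonoidHom

omit [NumberField F] in
theorem antiUnit_apply (σ : F ≃+* F) (u : (𝓞 F)ˣ) :
    antiUnit σ u = u / Units.map (RingOfIntegers.mapRingHom (σ : F →+* F)).toMonoidHom u := rfl

omit [NumberField F] in
theorem log_place_antiUnit (σ : F ≃+* F) (u : (𝓞 F)ˣ) (w : InfinitePlace F) :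
    Real.log (w (antiUnit σ u : F)) = Real.log (w (u : F)) - Real.log (conjPlace σ w (u : F)) := by
  have h : antiUnit σ u * Units.map (RingOfIntegers.mapRingHom (σ : F →+* F)).toMonoidHom u = u :=
    div_mul_cancel _ _
  have h' : ((antiUnit σ u : 𝓞 F) : F) * σ (u : F) = u := congrArg (fun v : (𝓞 F)ˣ => (v : F)) h
  have hu : ∀ v : (𝓞 F)ˣ, w (v : F) ≠ 0 := fun v => (Units.pos_at_place v w).ne'
  have hσu : w (σ (u : F)) ≠ 0 := ((conjPlace σ w).pos_iff.2 (Units.coe_ne_zero u)).ne'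
  rw [conjPlace_apply, eq_sub_iff_add_eq, ← Real.log_mul (hu _) hσu, ← map_mul, h']

omit [NumberField F] in
theorem log_conjPlace_antiUnit {σ : F ≃+* F} (hσ : Function.Involutive σ) (u : (𝓞 F)ˣ)
    (w : InfinitePlace F) :
    Real.log (conjPlace σ w (antiUnit σ u : F)) = -Real.log (w (antiUnit σ u : F)) := by
  rw [log_place_antiUnit, log_place_antiUnit, conjPlace_involutive hσ w, neg_sub]

/-- A set of places which contains exactly one place from each two-element orbit of an involution,
and no fixed place. -/
structure IsHalfSystem {X : Type*} (s : X → X) (P : X → Prop) : Prop where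
  or_of_ne : ∀ w, s w ≠ w → P w ∨ P (s w)
  not_conj : ∀ w, P w → ¬ P (s w)

/-- Number the elements and take the smaller one of each two-element orbit. -/
theorem exists_isHalfSystem {X : Type*} [Finite X] {s : X → X} (hs : Function.Involutive s) :
    ∃ P, IsHalfSystem s P := by
  obtain ⟨n, ⟨e⟩⟩ := Finite.exists_equiv_fin X
  refine ⟨fun w => e w < e (s w), fun w hw => ?_, fun w hw => ?_⟩
  · rw [hs w]
    exact lt_or_gt_of_ne fun h => hw (e.injective h).symm
  · rw [hs w]
    exact hw.asymm

theorem IsHalfSystem.ne {X : Type*} {s : X → X} {P : X → Prop} (h : IsHalfSystem s P) {w : X}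
    (hw : P w) : s w ≠ w := fun h' => h.not_conj w hw (by rwa [h'])

/-- The logarithms of `u / σ u` at the places in `P`. -/
def antiLog (σ : F ≃+* F) (P : InfinitePlace F → Prop) :
    Additive (𝓞 F)ˣ →+ ({w // P w} → ℝ) where
  toFun u w := Real.log (w.1 (antiUnit σ u.toMul : F))
  map_zero' := by
    ext w
    simp
  map_add' u v := by
    ext w
    have h : ∀ v : (𝓞 F)ˣ, w.1 (v : F) ≠ 0 := fun v => (Units.pos_at_place v w.1).ne'
    rw [Pi.add_apply, ← Real.log_mul (h _) (h _), ← map_mul, toMul_add, map_mul]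
    rfl

omit [NumberField F] in
theorem antiLog_apply (σ : F ≃+* F) (P : InfinitePlace F → Prop) (u : (𝓞 F)ˣ) (w : {w // P w}) :
    antiLog σ P (Additive.ofMul u) w = Real.log (w.1 (antiUnit σ u : F)) := rfl

omit [NumberField F] in
-- The logarithm of `u / σ u` vanishes at fixed places and changes sign between conjugate places, so
-- the places in `P` control all of them.
theorem abs_log_antiUnit_le {σ : F ≃+* F} (hσ : Function.Involutive σ)
    {P : InfinitePlace F → Prop} (hP : IsHalfSystem (conjPlace σ) P) {u : (𝓞 F)ˣ} {r : ℝ}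
    (hr : 0 ≤ r) (h : ∀ w : {w // P w}, |antiLog σ P (Additive.ofMul u) w| ≤ r)
    (w : InfinitePlace F) : |Real.log (w (antiUnit σ u : F))| ≤ r := by
  by_cases hw : conjPlace σ w = w
  · rwa [log_place_antiUnit, hw, sub_self, abs_zero]
  · rcases hP.or_of_ne w hw with hp | hp
    · exact h ⟨w, hp⟩
    · have := h ⟨conjPlace σ w, hp⟩
      rwa [antiLog_apply, log_conjPlace_antiUnit hσ, abs_neg] at this

variable (F) in
-- Only finitely many algebraic integers of `F` have all their conjugates bounded.
theorem finite_units_log_le (r : ℝ) :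
    {v : (𝓞 F)ˣ | ∀ w : InfinitePlace F, Real.log (w (v : F)) ≤ r}.Finite := by
  refine Set.Finite.of_finite_image ?_ (Units.coe_injective F).injOn
  refine (Embeddings.finite_of_norm_le F ℂ (Real.exp r)).subset ?_
  rintro _ ⟨v, hv, rfl⟩
  refine ⟨v.val.isIntegral_coe, (InfinitePlace.le_iff_le _ _).1 fun w => ?_⟩
  exact (Real.log_le_iff_le_exp (Units.pos_at_place v w)).1 (hv w)

theorem antiUnit_mem_torsion {σ : F ≃+* F} (hσ : Function.Involutive σ)
    {P : InfinitePlace F → Prop} (hP : IsHalfSystem (conjPlace σ) P) {u : (𝓞 F)ˣ}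
    (h : antiLog σ P (Additive.ofMul u) = 0) : antiUnit σ u ∈ Units.torsion F := by
  rw [Units.mem_torsion]
  intro w
  have := abs_log_antiUnit_le hσ hP le_rfl (u := u) (fun w => by simp [h]) w
  have h0 : Real.log (w (antiUnit σ u : F)) = 0 := abs_eq_zero.1 (le_antisymm this (abs_nonneg _))
  exact Real.eq_one_of_pos_of_log_eq_zero (Units.pos_at_place _ w) h0

variable (σ : F ≃+* F) (P : InfinitePlace F → Prop)

/-- The lattice formed by the logarithms of the units `u / σ u`. -/
def antiLattice : Submodule ℤ ({w // P w} → ℝ) := LinearMap.range (antiLog σ P).toIntLinearMap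

variable {σ P}

open scoped Classical in
-- A lattice point in the unit ball comes from a unit `u / σ u` bounded at all places, and there are
-- finitely many such units.
theorem discreteTopology_antiLattice (hσ : Function.Involutive σ)
    (hP : IsHalfSystem (conjPlace σ) P) : DiscreteTopology (antiLattice σ P) := by
  refine discreteTopology_of_isOpen_singleton_zero ?_
  refine isOpen_singleton_of_finite_mem_nhds 0 (s := Metric.closedBall 0 1) ?_ ?_
  · exact Metric.closedBall_mem_nhds _ (by simp)
  · refine Set.Finite.of_finite_image ?_ (Set.injOn_of_injective Subtype.val_injective)
    refine ((finite_units_log_le F 1).image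
      fun (v : (𝓞 F)ˣ) (w : {w // P w}) => Real.log (w.1 (v : F))).subset ?_
    rintro _ ⟨⟨_, ⟨u, rfl⟩⟩, hu, rfl⟩
    refine ⟨antiUnit σ u.toMul, fun w => ?_, rfl⟩
    refine (le_abs_self _).trans (abs_log_antiUnit_le hσ hP zero_le_one (fun v => ?_) w)
    rw [mem_closedBall_zero_iff] at hu
    exact (norm_le_pi_norm (antiLog σ P u) v).trans hu

open scoped Classical in
-- A linear form killing the lattice, with coefficients `g` extended by zero off `P`, gives the
-- relation `∑ (g w - g (σ w)) log |u|_w = 0` on all units. Its coefficients are then proportional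
-- to the local degrees; being antisymmetric they sum to zero, so they vanish. As `P` never contains
-- both `w` and `σ w`, `g = 0` on `P`.
theorem span_antiLattice (hσ : Function.Involutive σ) (hP : IsHalfSystem (conjPlace σ) P) :
    Submodule.span ℝ (antiLattice σ P : Set ({w // P w} → ℝ)) = ⊤ := by
  by_contra hne
  obtain ⟨f, hf0, hf⟩ := Submodule.exists_le_ker_of_lt_top _ (lt_top_iff_ne_top.2 hne)
  apply hf0
  have hfsum : ∀ x, f x = ∑ w, x w * f (Pi.single w 1) := fun x => by
    rw [LinearMap.pi_apply_eq_sum_univ f x]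
    refine Finset.sum_congr rfl fun w _ => ?_
    rw [smul_eq_mul]
    congr 2
    ext j
    simp [Pi.single_apply, eq_comm]
  let g : InfinitePlace F → ℝ := fun w => if h : P w then f (Pi.single ⟨w, h⟩ 1) else 0
  let e := (conjPlace_involutive hσ).toPerm
  have hsum : ∀ u : (𝓞 F)ˣ,
      ∑ w, (g w - g (conjPlace σ w)) * Real.log (w (u : F)) = 0 := by
    intro u
    have h1 : ∑ w, g (conjPlace σ w) * Real.log (w (u : F)) =
        ∑ w, g w * Real.log (conjPlace σ w (u : F)) := by
      rw [← Equiv.sum_comp e]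
      refine Finset.sum_congr rfl fun w _ => ?_
      change g (conjPlace σ (conjPlace σ w)) * _ = _
      rw [conjPlace_involutive hσ w]
      rfl
    have h2 : f (antiLog σ P (Additive.ofMul u)) = 0 :=
      hf (Submodule.subset_span ⟨Additive.ofMul u, rfl⟩)
    rw [hfsum] at h2
    rw [← h2]
    simp only [sub_mul, Finset.sum_sub_distrib, h1]
    rw [← Finset.sum_sub_distrib]
    refine (Fintype.sum_of_injective Subtype.val Subtype.val_injective _ _ (fun w hw => ?_)
      fun w => ?_).symm
    · have hw' : ¬ P w := fun h => hw ⟨⟨w, h⟩, rfl⟩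
      simp only [g, dif_neg hw', zero_mul, sub_zero]
    · simp only [g, dif_pos w.2, antiLog_apply, log_place_antiUnit]
      ring
  obtain ⟨t, ht⟩ := exists_eq_mul_mult_of_sum_log_eq_zero _ hsum
  have ht0 : t = 0 := by
    have h1 : ∑ w, (g w - g (conjPlace σ w)) = 0 := by
      rw [Finset.sum_sub_distrib, sub_eq_zero]
      exact (Equiv.sum_comp e g).symm
    simp only [ht, ← Finset.mul_sum] at h1
    refine (mul_eq_zero.1 h1).resolve_right ?_
    rw [← Nat.cast_sum, InfinitePlace.sum_mult_eq]
    exact_mod_cast Module.finrank_pos.ne'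
  refine LinearMap.ext fun x => ?_
  rw [hfsum]
  refine Finset.sum_eq_zero fun w _ => ?_
  have := ht w.1
  simp only [g, dif_pos w.2, dif_neg (hP.not_conj _ w.2), ht0, zero_mul, sub_zero] at this
  rw [this, mul_zero]

open scoped Classical in
/-- There are units `ε_j` such that the logarithms of `ε_j / σ ε_j` form a real basis of `ℝ ^ P` and
an integral basis of the lattice formed by the logarithms of all `u / σ u`. -/
theorem exists_units_basis (hσ : Function.Involutive σ) (hP : IsHalfSystem (conjPlace σ) P) :
    ∃ (ε : {w // P w} → (𝓞 F)ˣ) (b : Module.Basis {w // P w} ℝ ({w // P w} → ℝ)),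
      (∀ j, b j = antiLog σ P (Additive.ofMul (ε j))) ∧
      ∀ u : (𝓞 F)ˣ, ∃ n : {w // P w} → ℤ,
        antiLog σ P (Additive.ofMul (u / ∏ j, ε j ^ n j)) = 0 := by
  have := discreteTopology_antiLattice hσ hP
  have : IsZLattice ℝ (antiLattice σ P) := ⟨span_antiLattice hσ hP⟩
  have := ZLattice.module_free ℝ (antiLattice σ P)
  have := ZLattice.module_finite ℝ (antiLattice σ P)
  have hrank : Module.finrank ℤ (antiLattice σ P) = Fintype.card {w // P w} := by
    rw [ZLattice.rank ℝ, Module.finrank_fintype_fun_eq_card]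
  let b₀ : Module.Basis {w // P w} ℤ (antiLattice σ P) :=
    (Module.finBasisOfFinrankEq ℤ _ hrank).reindex (Fintype.equivFin _).symm
  have hε : ∀ j, ∃ u : (𝓞 F)ˣ, antiLog σ P (Additive.ofMul u) = b₀ j := fun j => by
    obtain ⟨u, hu⟩ := (b₀ j).2
    exact ⟨u.toMul, hu⟩
  choose ε hε using hε
  refine ⟨ε, b₀.ofZLatticeBasis ℝ _, fun j => ?_, fun u => ?_⟩
  · rw [Module.Basis.ofZLatticeBasis_apply, hε]
  · let x : antiLattice σ P := ⟨antiLog σ P (Additive.ofMul u), Additive.ofMul u, rfl⟩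
    refine ⟨b₀.repr x, ?_⟩
    have h := congrArg (fun y : antiLattice σ P => (y : {w // P w} → ℝ)) (b₀.sum_repr x)
    simp only [Submodule.coe_sum, Submodule.coe_smul_of_tower, ← hε] at h
    rw [ofMul_div, map_sub, ofMul_prod, map_sum, sub_eq_zero]
    simp only [ofMul_zpow, map_zsmul]
    exact h.symm

end AntiUnits

/-! ### Anti-invariant types -/

section AntiTypes

theorem phase_of_conj {z z' : ℂˣ} (h : (z' : ℂ) = (starRingEnd ℂ) (z : ℂ)) :
    phase z' = (phase z)⁻¹ := by
  ext
  rw [Circle.coe_inv_eq_conj, coe_phase, coe_phase, h, map_div₀, Complex.conj_ofReal,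
    Complex.norm_conj]

variable {F : Type*} [Field F]

/-- The embeddings chosen at `w` and at its conjugate place agree up to complex conjugation; the sign
`δ_w` records whether the conjugation is needed. It can be taken to be `-1` at fixed places. -/
theorem exists_conjSign {σ : F ≃+* F} (hne : σ ≠ RingEquiv.refl F) :
    ∃ δ : InfinitePlace F → ℤ, (∀ w, conjPlace σ w = w → δ w = -1 ∧ w.IsComplex) ∧
      ∀ w (x : Fˣ), phase (embeddings (Units.map (σ : F →+* F).toMonoidHom x) w) =
        phase (embeddings x (conjPlace σ w)) ^ δ w := by
  suffices h : ∀ w : InfinitePlace F, ∃ δ : ℤ, (conjPlace σ w = w → δ = -1 ∧ w.IsComplex) ∧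
      ∀ x : Fˣ, phase (embeddings (Units.map (σ : F →+* F).toMonoidHom x) w) =
        phase (embeddings x (conjPlace σ w)) ^ δ by
    choose δ hδ hδ' using h
    exact ⟨δ, hδ, hδ'⟩
  intro w
  have hmk : InfinitePlace.mk (conjPlace σ w).embedding =
      InfinitePlace.mk (w.embedding.comp (σ : F →+* F)) := by
    rw [InfinitePlace.mk_embedding, ← InfinitePlace.comap_mk, InfinitePlace.mk_embedding]
    rfl
  -- At a fixed place `σ` must act through complex conjugation: were the embeddings equal, `σ` would
  -- be the identity. This gives the sign `-1` there and excludes real fixed places.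
  have hfix : w.embedding ≠ w.embedding.comp (σ : F →+* F) := fun h =>
    hne (RingEquiv.ext fun x => w.embedding.injective (RingHom.congr_fun h x).symm)
  rcases InfinitePlace.mk_eq_iff.1 hmk with h | h
  · refine ⟨1, fun hw => absurd (by rwa [hw] at h) hfix, fun x => ?_⟩
    rw [zpow_one]
    congr 1
    ext
    exact (RingHom.congr_fun h x).symm
  · refine ⟨-1, fun hw => ⟨rfl, ?_⟩, fun x => ?_⟩
    · rw [← InfinitePlace.not_isReal_iff_isComplex]
      intro hr
      rw [hw, InfinitePlace.conjugate_embedding_eq_of_isReal hr] at h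
      exact hfix h
    · rw [zpow_neg_one]
      exact phase_of_conj (RingHom.congr_fun h x).symm

/-- The type of the character `x ↦ ψ (x / σ x)`, where `ψ` is the character of type `τ`. -/
def antiType (σ : F ≃+* F) (δ : InfinitePlace F → ℤ) :
    (InfinitePlace F → ℤ) × (InfinitePlace F → ℝ) →+
      (InfinitePlace F → ℤ) × (InfinitePlace F → ℝ) where
  toFun τ := (fun w => τ.1 w - δ (conjPlace σ w) * τ.1 (conjPlace σ w),
    fun w => τ.2 w - τ.2 (conjPlace σ w))
  map_zero' := by ext <;> simp
  map_add' τ τ' := by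
    ext w
    · change τ.1 w + τ'.1 w - _ * (τ.1 _ + τ'.1 _) = (τ.1 w - _) + (τ'.1 w - _)
      ring
    · change τ.2 w + τ'.2 w - (τ.2 _ + τ'.2 _) = (τ.2 w - _) + (τ'.2 w - _)
      ring

theorem antiType_fst (σ : F ≃+* F) (δ : InfinitePlace F → ℤ)
    (τ : (InfinitePlace F → ℤ) × (InfinitePlace F → ℝ)) (w : InfinitePlace F) :
    (antiType σ δ τ).1 w = τ.1 w - δ (conjPlace σ w) * τ.1 (conjPlace σ w) := rfl

theorem antiType_snd (σ : F ≃+* F) (δ : InfinitePlace F → ℤ)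
    (τ : (InfinitePlace F → ℤ) × (InfinitePlace F → ℝ)) (w : InfinitePlace F) :
    (antiType σ δ τ).2 w = τ.2 w - τ.2 (conjPlace σ w) := rfl

variable [NumberField F] {σ : F ≃+* F}

/-- The contribution of `σ x` at `w` is that of `x` at the conjugate place, up to the sign `δ w` on
phases; reindexing over places by the involution collects it in the type. -/
theorem torusChar_antiType (hσ : Function.Involutive σ) {δ : InfinitePlace F → ℤ}
    (hδ : ∀ w (x : Fˣ), phase (embeddings (Units.map (σ : F →+* F).toMonoidHom x) w) =
        phase (embeddings x (conjPlace σ w)) ^ δ w)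
    (τ : (InfinitePlace F → ℤ) × (InfinitePlace F → ℝ)) (x : Fˣ) :
    (torusChar (antiType σ δ τ)).toMul (embeddings x) =
      (torusChar τ).toMul (embeddings (x / Units.map (σ : F →+* F).toMonoidHom x)) := by
  let e := (conjPlace_involutive hσ).toPerm
  have he : ∀ w, e w = conjPlace σ w := fun _ => rfl
  have hee : ∀ w, conjPlace σ (conjPlace σ w) = w := conjPlace_involutive hσ
  have hnorm : ∀ (y : Fˣ) (w : InfinitePlace F), ‖(embeddings y w : ℂ)‖ = w y := fun y w => by
    rw [embeddings_apply, InfinitePlace.norm_embedding_eq]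
  have hlog : ∀ w : InfinitePlace F,
      Real.log (w ((x / Units.map (σ : F →+* F).toMonoidHom x : Fˣ) : F)) =
        Real.log (w (x : F)) - Real.log (conjPlace σ w (x : F)) := fun w => by
    rw [Units.val_div_eq_div_val, map_div₀, Real.log_div]
    · rfl
    · exact (w.pos_iff.2 x.ne_zero).ne'
    · exact (w.pos_iff.2 (Units.ne_zero _)).ne'
  rw [torusChar_apply, torusChar_apply]
  congr 1
  · simp only [antiType_fst, zpow_sub, Finset.prod_mul_distrib, Finset.prod_inv_distrib, map_div,
      Pi.div_apply, div_zpow, Finset.prod_div_distrib, hδ]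
    rw [div_eq_mul_inv]
    congr 2
    rw [← Equiv.prod_comp e]
    refine Finset.prod_congr rfl fun w _ => ?_
    rw [he, hee, zpow_mul]
  · congr 1
    simp only [hnorm, hlog, antiType_snd, sub_mul, mul_sub, Finset.sum_sub_distrib]
    congr 1
    rw [← Equiv.sum_comp e]
    refine Finset.sum_congr rfl fun w _ => ?_
    rw [he, hee]

theorem torusChar_antiType_unit (hσ : Function.Involutive σ) {δ : InfinitePlace F → ℤ}
    (hδ : ∀ w (x : Fˣ), phase (embeddings (Units.map (σ : F →+* F).toMonoidHom x) w) =
        phase (embeddings x (conjPlace σ w)) ^ δ w)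
    (τ : (InfinitePlace F → ℤ) × (InfinitePlace F → ℝ)) (u : (𝓞 F)ˣ) :
    (torusChar (antiType σ δ τ)).toMul
        (embeddings (Units.map (algebraMap (𝓞 F) F).toMonoidHom u)) =
      (torusChar τ).toMul
        (embeddings (Units.map (algebraMap (𝓞 F) F).toMonoidHom (antiUnit σ u))) := by
  rw [torusChar_antiType hσ hδ, antiUnit_apply,
    map_div (Units.map (algebraMap (𝓞 F) F).toMonoidHom)]
  rfl

/-- A multiple of an anti-invariant type is admissible as soon as the type is trivial on units
generating the lattice of the `u / σ u`. -/
theorem isUnitType_antiType (hσ : Function.Involutive σ) {δ : InfinitePlace F → ℤ}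
    (hδ : ∀ w (x : Fˣ), phase (embeddings (Units.map (σ : F →+* F).toMonoidHom x) w) =
        phase (embeddings x (conjPlace σ w)) ^ δ w)
    {P : InfinitePlace F → Prop} (hP : IsHalfSystem (conjPlace σ) P)
    {ι : Type*} [Fintype ι] {ε : ι → (𝓞 F)ˣ}
    (hε : ∀ u : (𝓞 F)ˣ, ∃ n : ι → ℤ,
      antiLog σ P (Additive.ofMul (u / ∏ j, ε j ^ n j)) = 0)
    {τ : (InfinitePlace F → ℤ) × (InfinitePlace F → ℝ)}
    (hτ : ∀ j, (torusChar τ).toMul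
      (embeddings (Units.map (algebraMap (𝓞 F) F).toMonoidHom (antiUnit σ (ε j)))) = 1)
    (hreal : ∀ w : InfinitePlace F, w.IsReal → τ.1 w = 0) :
    IsUnitType ((Units.torsionOrder F : ℤ) • antiType σ δ τ) where
  units u := by
    let h : (𝓞 F)ˣ →* Circle := (torusChar τ).toMul.comp
      (embeddings.comp ((Units.map (algebraMap (𝓞 F) F).toMonoidHom).comp (antiUnit σ)))
    obtain ⟨n, hn⟩ := hε u
    -- Dividing by the `ε j` leaves a unit whose `u / σ u` is a root of unity, killed by the torsion
    -- order.
    have h1 : h u = h (u / ∏ j, ε j ^ n j) := by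
      have h2 : h (∏ j, ε j ^ n j) = 1 := by
        rw [map_prod]
        refine Finset.prod_eq_one fun j _ => ?_
        rw [map_zpow, show h (ε j) = 1 from hτ j, one_zpow]
      rw [map_div, h2, div_one]
    have h3 := antiUnit_mem_torsion hσ hP hn
    have h4 : antiUnit σ (u / ∏ j, ε j ^ n j) ^ Units.torsionOrder F = 1 := by
      have : (⟨_, h3⟩ : Units.torsion F) ^ Nat.card (Units.torsion F) = 1 := pow_card_eq_one'
      exact congrArg Subtype.val this
    have h5 : h u ^ Units.torsionOrder F = 1 := by
      rw [h1, ← map_pow]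
      change (torusChar τ).toMul (embeddings (Units.map _ (antiUnit σ (_ ^ _)))) = 1
      rw [map_pow, h4, map_one, map_one, map_one]
    rw [natCast_zsmul, map_nsmul, toMul_nsmul, MonoidHom.pow_apply, torusChar_antiType_unit hσ hδ]
    exact h5
  real w hw := by
    have h0 : τ.1 (conjPlace σ w) = 0 := hreal _ ((InfinitePlace.isReal_comap_iff σ).2 hw)
    change (Units.torsionOrder F : ℤ) • (antiType σ δ τ).1 w = 0
    rw [antiType_fst, hreal w hw, h0, mul_zero, sub_zero, smul_zero]
  sum := by
    have h0 : ∑ w, (antiType σ δ τ).2 w = 0 := by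
      simp only [antiType_snd, Finset.sum_sub_distrib]
      rw [sub_eq_zero]
      exact (Equiv.sum_comp (conjPlace_involutive hσ).toPerm τ.2).symm
    change ∑ w, (Units.torsionOrder F : ℤ) • (antiType σ δ τ).2 w = 0
    rw [← Finset.smul_sum, h0, smul_zero]

end AntiTypes

/-! ### Independent admissible types: construction and count -/

section Existence

universe v

/-- Extension by zero of a vector indexed by a subtype. -/
def extendZero {X : Type*} (P : X → Prop) [DecidablePred P] (φ : {w // P w} → ℝ) (w : X) : ℝ :=
  if h : P w then φ ⟨w, h⟩ else 0

theorem extendZero_of_pos {X : Type*} {P : X → Prop} [DecidablePred P] (φ : {w // P w} → ℝ)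
    (w : {w // P w}) : extendZero P φ w = φ w := dif_pos w.2

theorem extendZero_of_neg {X : Type*} {P : X → Prop} [DecidablePred P] (φ : {w // P w} → ℝ)
    {w : X} (hw : ¬ P w) : extendZero P φ w = 0 := dif_neg hw

theorem sum_extendZero_mul {X : Type*} [Fintype X] {P : X → Prop} [DecidablePred P]
    (φ : {w // P w} → ℝ) (l : X → ℝ) :
    ∑ w, extendZero P φ w * l w = ∑ w : {w // P w}, φ w * l w := by
  refine (Fintype.sum_of_injective Subtype.val Subtype.val_injective _ _ (fun w hw => ?_)
      fun w => ?_).symm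
  · rw [extendZero_of_neg φ fun h => hw ⟨⟨w, h⟩, rfl⟩, zero_mul]
  · rw [extendZero_of_pos]

/-- A linear form may be prescribed on a basis, and `φ` is its coordinate vector. -/
theorem exists_sum_mul_basis_eq {S : Type*} [Fintype S] (b : Module.Basis S ℝ (S → ℝ))
    (c : S → ℝ) : ∃ φ : S → ℝ, ∀ j, ∑ w, φ w * b j w = c j := by
  classical
  obtain ⟨f, hf⟩ : ∃ f : (S → ℝ) →ₗ[ℝ] ℝ, ∀ j, f (b j) = c j :=
    ⟨b.constr ℝ c, b.constr_basis ℝ c⟩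
  refine ⟨fun w => f (Pi.single w 1), fun j => ?_⟩
  rw [← hf j, LinearMap.pi_apply_eq_sum_univ f (b j)]
  refine Finset.sum_congr rfl fun w _ => ?_
  rw [smul_eq_mul, mul_comm]
  refine congrArg (_ * ·) (congrArg f (funext fun i => ?_))
  simp [Pi.single_apply, eq_comm]

variable {F : Type v} [Field F] [NumberField F] {σ : F ≃+* F}

open scoped Classical in
/-- Half of the places counted with multiplicity. -/
theorem two_mul_card_eq_finrank (hσ : Function.Involutive σ)
    (hfix : ∀ w : InfinitePlace F, conjPlace σ w = w → w.IsComplex)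
    {P : InfinitePlace F → Prop} (hP : IsHalfSystem (conjPlace σ) P) :
    2 * (Fintype.card {w : InfinitePlace F // w.IsComplex ∧ (P w ∨ conjPlace σ w = w)} +
      Fintype.card {w // P w}) = Module.finrank ℚ F := by
  -- `g` places the parameters: `1` at a fixed place (complex, of degree `2`), the local degree at a
  -- place in `P`, and `0` at its conjugate.
  let g : InfinitePlace F → ℕ := fun w =>
    (if w.IsComplex ∧ (P w ∨ conjPlace σ w = w) then 1 else 0) + if P w then 1 else 0
  have hg : ∀ w : InfinitePlace F, w.mult = g w + g (conjPlace σ w) := by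
    intro w
    have hee := conjPlace_involutive hσ w
    have hc := isComplex_conjPlace_iff σ w
    have hm : w.mult = if w.IsComplex then 2 else 1 := by
      split_ifs with h
      · exact h.mult_eq_two
      · exact (InfinitePlace.not_isComplex_iff_isReal.1 h).mult_eq_one
    by_cases hw : conjPlace σ w = w
    · have h1 : ¬ P w := fun h => hP.ne h hw
      simp [g, hm, hw, h1, hfix w hw]
    · have hw' : w ≠ conjPlace σ w := fun h => hw h.symm
      by_cases h1 : P w
      · have h2 := hP.not_conj w h1
        by_cases h3 : w.IsComplex <;> simp [g, hm, hee, hw', hc, h1, h2, h3]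
      · have h2 := (hP.or_of_ne w hw).resolve_left h1
        by_cases h3 : w.IsComplex <;> simp [g, hm, hee, hw, hc, h1, h2, h3]
  have hsum : ∑ w, g (conjPlace σ w) = ∑ w, g w :=
    Equiv.sum_comp (conjPlace_involutive hσ).toPerm g
  rw [← InfinitePlace.sum_mult_eq, Finset.sum_congr rfl fun w _ => hg w, Finset.sum_add_distrib,
    hsum, ← two_mul, Finset.sum_add_distrib, Fintype.card_subtype, Fintype.card_subtype,
    Finset.card_filter, Finset.card_filter]

/-- There are `[F : ℚ] / 2` independent admissible types with `φ_w = 0` at all fixed places `w`. -/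
theorem exists_linearIndependent_isUnitType (hσ : Function.Involutive σ)
    (hne : σ ≠ RingEquiv.refl F) :
    ∃ (ι : Type v) (_ : Fintype ι) (τ : ι → (InfinitePlace F → ℤ) × (InfinitePlace F → ℝ)),
      LinearIndependent ℤ τ ∧ (∀ i, IsUnitType (τ i)) ∧
      (∀ i w, conjPlace σ w = w → (τ i).2 w = 0) ∧
      2 * Fintype.card ι = Module.finrank ℚ F := by
  classical
  obtain ⟨P, hP⟩ := exists_isHalfSystem (conjPlace_involutive hσ)
  obtain ⟨δ, hδfix, hδ⟩ := exists_conjSign hne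
  obtain ⟨ε, b, hb, hε⟩ := exists_units_basis hσ hP
  let K := {w : InfinitePlace F // w.IsComplex ∧ (P w ∨ conjPlace σ w = w)}
  let S := {w : InfinitePlace F // P w}
  let x : S → InfinitePlace F → ℂˣ := fun j =>
    embeddings (Units.map (algebraMap (𝓞 F) F).toMonoidHom (antiUnit σ (ε j)))
  -- `θ u j` is the angle by which the phase at `u` fails to be trivial on `ε j / σ (ε j)`; `α u`
  -- cancels it. The `β i` form `2π` times the basis dual to `b`, so they contribute only angles `0`
  -- and `2π`.
  choose θ hθ using fun (u : K) (j : S) =>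
    Circle.exp_surjective ((torusChar (Pi.single u.1 (1 : ℤ), 0)).toMul (x j))
  choose α hα using fun u : K => exists_sum_mul_basis_eq b fun j => -θ u j
  choose β hβ using fun i : S => exists_sum_mul_basis_eq b (Pi.single i (2 * Real.pi))
  let ψ : K ⊕ S → (InfinitePlace F → ℤ) × (InfinitePlace F → ℝ) :=
    Sum.elim (fun u => (Pi.single u.1 1, extendZero P (α u))) fun i => (0, extendZero P (β i))
  have hx : ∀ (φ : S → ℝ) j, (torusChar ((0 : InfinitePlace F → ℤ), extendZero P φ)).toMul (x j) =
      Circle.exp (∑ w, φ w * b j w) := fun φ j => by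
    have hnorm : ∀ w, ‖(x j w : ℂ)‖ = w (antiUnit σ (ε j) : F) := fun w => by
      rw [embeddings_apply, InfinitePlace.norm_embedding_eq]
      rfl
    rw [torusChar_apply]
    simp only [Pi.zero_apply, zpow_zero, Finset.prod_const_one, one_mul, hnorm]
    rw [sum_extendZero_mul φ fun w => Real.log (w (antiUnit σ (ε j) : F)), hb]
    rfl
  have hψ : ∀ i j, (torusChar (ψ i)).toMul (x j) = 1 := by
    rintro (u | i) j
    · have h : ψ (Sum.inl u) = (Pi.single u.1 1, 0) + (0, extendZero P (α u)) := by
        simp [ψ]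
      rw [h, torusChar_add_apply, hx, hα, ← hθ, ← Circle.exp_add, add_neg_cancel, Circle.exp_zero]
    · refine (hx (β i) j).trans ?_
      rw [hβ, Pi.single_apply]
      split_ifs
      · exact Circle.exp_two_pi
      · exact Circle.exp_zero
  have hψreal : ∀ i (w : InfinitePlace F), w.IsReal → (ψ i).1 w = 0 := by
    rintro (u | i) w hw
    · have h : w ≠ u.1 := by
        rintro rfl
        exact InfinitePlace.not_isReal_iff_isComplex.2 u.2.1 hw
      exact Pi.single_eq_of_ne (M := fun _ => ℤ) h 1
    · rfl
  refine ⟨K ⊕ S, inferInstance, fun i => (Units.torsionOrder F : ℤ) • antiType σ δ (ψ i),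
    ?_, fun i => isUnitType_antiType hσ hδ hP hε (hψ i) (hψreal i), fun i w hw => ?_, ?_⟩
  · rw [Fintype.linearIndependent_iff]
    intro n hn
    -- The torsion order is a nonzero integer and types form a torsion-free group.
    have hanti : antiType σ δ (∑ i, n i • ψ i) = 0 := by
      have h0 : (Units.torsionOrder F : ℤ) • antiType σ δ (∑ i, n i • ψ i) = 0 := by
        rw [map_sum, Finset.smul_sum, ← hn]
        refine Finset.sum_congr rfl fun i _ => ?_
        rw [map_zsmul, smul_comm]
      exact (smul_eq_zero.1 h0).resolve_left (by exact_mod_cast Units.torsionOrder_ne_zero F)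
    have hfst : ∀ w, (∑ i, n i • ψ i).1 w = ∑ u : K, n (Sum.inl u) *
        (Pi.single u.1 1 : InfinitePlace F → ℤ) w := by
      intro w
      simp [ψ, Fintype.sum_sum_type, Prod.fst_sum, Finset.sum_apply]
    have hfst' : ∀ u : K, (∑ i, n i • ψ i).1 u = n (Sum.inl u) := by
      intro u
      rw [hfst, Finset.sum_eq_single u (fun v _ hv => ?_) (by simp), Pi.single_eq_same, mul_one]
      rw [Pi.single_eq_of_ne (fun h => hv (Subtype.ext h.symm)), mul_zero]
    have hfst0 : ∀ w, ¬ (w.IsComplex ∧ (P w ∨ conjPlace σ w = w)) →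
        (∑ i, n i • ψ i).1 w = 0 := by
      intro w hw
      rw [hfst]
      refine Finset.sum_eq_zero fun u _ => ?_
      have h : w ≠ u.1 := by
        rintro rfl
        exact hw u.2
      rw [Pi.single_eq_of_ne h, mul_zero]
    have hK : ∀ u : K, n (Sum.inl u) = 0 := by
      intro u
      have h := congrFun (congrArg Prod.fst hanti) u.1
      rw [antiType_fst, hfst'] at h
      -- At a fixed place the sign `δ = -1` turns the relation into `2 n = 0`; at a place in `P` the
      -- conjugate place carries no `k`.
      by_cases hu : conjPlace σ u.1 = u.1
      · rw [hu, (hδfix u.1 hu).1, hfst'] at h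
        change _ = (0 : ℤ) at h
        linarith
      · have hPu := u.2.2.resolve_right hu
        rw [hfst0, mul_zero, sub_zero] at h
        · exact h
        · rintro ⟨-, h' | h'⟩
          · exact hP.not_conj _ hPu h'
          · rw [conjPlace_involutive hσ] at h'
            exact hu h'.symm
    have hsnd : ∀ w, (∑ i, n i • ψ i).2 w = ∑ i : S, n (Sum.inr i) * extendZero P (β i) w := by
      intro w
      simp [ψ, Fintype.sum_sum_type, Prod.snd_sum, Finset.sum_apply, hK]
    have hS : ∀ i : S, n (Sum.inr i) = 0 := by
      intro j
      have h1 : ∀ w : S, ∑ i : S, (n (Sum.inr i) : ℝ) * β i w = 0 := by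
        intro w
        have h := congrFun (congrArg Prod.snd hanti) w.1
        rw [antiType_snd, hsnd, hsnd] at h
        simp only [extendZero_of_pos, extendZero_of_neg _ (hP.not_conj _ w.2), mul_zero,
          Finset.sum_const_zero, sub_zero] at h
        exact h
      -- Pairing with `b j` leaves only `2π` times the coefficient of index `j`.
      have h2 : ∑ w, (∑ i : S, (n (Sum.inr i) : ℝ) * β i w) * b j w = 0 :=
        Finset.sum_eq_zero fun w _ => by rw [h1 w, zero_mul]
      simp only [Finset.sum_mul, mul_assoc] at h2
      rw [Finset.sum_comm] at h2
      simp only [← Finset.mul_sum, hβ] at h2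
      rw [Finset.sum_eq_single j (fun i _ hi => by rw [Pi.single_eq_of_ne hi.symm, mul_zero])
        (by simp), Pi.single_eq_same] at h2
      have h3 := (mul_eq_zero.1 h2).resolve_right Real.two_pi_pos.ne'
      exact_mod_cast h3
    rintro (u | i)
    · exact hK u
    · exact hS i
  · change (Units.torsionOrder F : ℤ) • (antiType σ δ (ψ i)).2 w = 0
    rw [antiType_snd, hw, sub_self, smul_zero]
  · rw [Fintype.card_sum]
    exact two_mul_card_eq_finrank hσ (fun w hw => (hδfix w hw).2) hP

end Existence

/-! ### The involution of a quadratic extension and its fixed places -/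

section Quadratic

variable {F₀ F : Type*} [Field F₀] [NumberField F₀] [Field F] [NumberField F] [Algebra F₀ F]

theorem exists_involution (hquad : Module.finrank F₀ F = 2) :
    ∃ σ : F ≃ₐ[F₀] F, σ ≠ 1 ∧ Function.Involutive σ ∧ ∀ g : F ≃ₐ[F₀] F, g = 1 ∨ g = σ := by
  have : Algebra.IsQuadraticExtension F₀ F := ⟨hquad⟩
  have hcard : Nat.card (F ≃ₐ[F₀] F) = 2 := by rw [IsGalois.card_aut_eq_finrank, hquad]
  obtain ⟨σ, hσ⟩ := (Nat.card_eq_two_iff' (1 : F ≃ₐ[F₀] F)).1 hcard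
  refine ⟨σ, hσ.1, fun x => ?_, fun g => or_iff_not_imp_left.2 (hσ.2 g)⟩
  have : σ * σ = 1 := by
    have := pow_card_eq_one' (x := σ)
    rwa [hcard, sq] at this
  exact AlgEquiv.congr_fun this x

/-- A complex place above a real one is fixed by the nontrivial automorphism. -/
theorem conjPlace_eq_of_isReal_comap (hquad : Module.finrank F₀ F = 2) {σ : F ≃ₐ[F₀] F}
    (hσ : Function.Involutive σ) (hall : ∀ g : F ≃ₐ[F₀] F, g = 1 ∨ g = σ) {w : InfinitePlace F}
    (hw : w.IsComplex) (hv : (w.comap (algebraMap F₀ F)).IsReal) :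
    conjPlace σ.toRingEquiv w = w := by
  have : Algebra.IsQuadraticExtension F₀ F := ⟨hquad⟩
  have h0 : (ComplexEmbedding.conjugate w.embedding).comp (algebraMap F₀ F) =
      w.embedding.comp (algebraMap F₀ F) := by
    have := InfinitePlace.conjugate_embedding_eq_of_isReal hv
    rw [InfinitePlace.comap_embedding_of_isReal _ hv] at this
    exact this
  -- The embedding at `w` and its conjugate agree on `F₀`, so they differ by a Galois element,
  -- nontrivial because `w` is complex. Hence `σ` acts as complex conjugation and preserves `w`.
  obtain ⟨g, hg⟩ := ComplexEmbedding.exists_comp_symm_eq_of_comp_eq _ _ h0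
  rcases hall g with rfl | rfl
  · exact absurd hg (by
      rw [InfinitePlace.isComplex_iff] at hw
      exact hw)
  · have hsymm : ∀ x, g.symm x = g x := fun x => by rw [AlgEquiv.symm_apply_eq, hσ x]
    refine InfinitePlace.ext _ _ fun x => ?_
    rw [conjPlace_apply, ← InfinitePlace.norm_embedding_eq, ← InfinitePlace.norm_embedding_eq w x]
    have h1 := RingHom.congr_fun hg x
    rw [← h1]
    simp [hsymm]

end Quadratic

end HeckeChar

end

theorem mainTheorem10 {F₀ F : Type*} [Field F₀] [NumberField F₀] [Field F] [NumberField F]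
    [Algebra F₀ F] (hquad : Module.finrank F₀ F = 2) (m : HeckeChar.Modulus F) :
    ∃ H : Subgroup (HeckeChar.HeckeCharacter F),
      H ≤ HeckeChar.charactersOfModulus m ∧
      H ≤ HeckeChar.normalizedCharacters F ∧
      Module.rank ℤ (Additive H) = Module.finrank ℚ F₀ ∧
      ∀ χ ∈ H, ∀ v ∈ HeckeChar.ramifiedRealPlaces F₀ F,
        ∀ w : NumberField.InfinitePlace F, w.comap (algebraMap F₀ F) = v →
          ∃ k : ℤ, HeckeChar.HasLocalParameters χ w k 0 := by
  obtain ⟨σ, hne, hσ, hall⟩ := HeckeChar.exists_involution hquad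
  have hne' : σ.toRingEquiv ≠ RingEquiv.refl F := fun h =>
    hne (AlgEquiv.ext fun x => RingEquiv.congr_fun h x)
  obtain ⟨ι, _, τ, hli, hτ, hfix, hcard⟩ :=
    HeckeChar.exists_linearIndependent_isUnitType (σ := σ.toRingEquiv) hσ hne'
  obtain ⟨H, h1, h2, h3, h4⟩ := HeckeChar.exists_subgroup_of_isUnitType τ hli hτ m
  refine ⟨H, h1, h2, ?_, ?_⟩
  · rw [h3, Nat.cast_inj]
    have := Module.finrank_mul_finrank ℚ F₀ F
    rw [hquad] at this
    omega
  · rintro χ hχ v ⟨hv, w', hw', hcw'⟩ w rfl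
    have : Algebra.IsQuadraticExtension F₀ F := ⟨hquad⟩
    -- One place above `v` is complex by assumption; the Galois group permutes the places above `v`
    -- transitively, so all of them are.
    have hcw : w.IsComplex := by
      obtain ⟨g, rfl⟩ := NumberField.InfinitePlace.exists_smul_eq_of_comap_eq hw'
      rw [← NumberField.InfinitePlace.not_isReal_iff_isComplex,
        NumberField.InfinitePlace.isReal_smul_iff,
        NumberField.InfinitePlace.not_isReal_iff_isComplex]
      exact hcw'
    exact h4 χ hχ w hcw fun i =>
      hfix i w (HeckeChar.conjPlace_eq_of_isReal_comap hquad hσ hall hcw hv)
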